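/- Let $n\in\mathbb N$, let $\Omega,\Omega'\subset\mathbb R^n$ be open bounded rectangular domains (products of bounded open intervals), let $T,\alpha,\beta,\gamma>0$. Equip $H^1(\Omega)$ with the norm $\|f\|_{H^1(\Omega)}^2=\gamma\|f\|_{L^2(\Omega)}^2+\|\nabla f\|_{L^2(\Omega)}^2$, let $H^{-1}_0(\Omega)$ be its dual space with the dual norm, and embed $L^2(\Omega)\subset H^{-1}_0(\Omega)$ by $f\mapsto(g\mapsto\int_\Omega fg)$. Let $\Delta_N:H^1(\Omega)\to H^{-1}_0(\Omega)$, $(\Delta_N f)(g)=-\int_\Omega\nabla f\cdot\nabla g$, be the (variational) Neumann Laplacian and $(-\Delta_N+\gamma I)^{-1}:H^{-1}_0(\Omega)\to H^1(\Omega)$ the inverse of $-\Delta_N+\gamma I$. Let $$\mathbb X=L^2(0,T;L^2(\Omega))\cap H^1(0,T;H^{-1}_0(\Omega)),\qquad \|\vartheta\|_{\mathbb X}^2=\|\vartheta\|_{L^2(0,T;L^2(\Omega))}^2+\|\partial_t\vartheta\|^2_{L^2(0,T;H^{-1}_0(\Omega))},$$ with $\partial_t$ the weak time derivative, let $\mathbb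 Y=L^2(0,T;L^2(\Omega'))$, let $A:\mathbb X\to\mathbb Y$ be linear and continuous, $\psi\in\mathbb Y$, and $$E(\vartheta)=\tfrac12\|A\vartheta-\psi\|^2_{\mathbb Y}+\tfrac\alpha2\|\vartheta\|^2_{L^2(0,T;L^2(\Omega))}+\tfrac\beta2\|\partial_t\vartheta\|^2_{L^2(0,T;H^{-1}_0(\Omega))},\qquad \vartheta\in\mathbb X .$$ For $\vartheta,h\in\mathbb X$ write $$\big\langle(-\Delta_N+\gamma I)^{-1}\partial_{tt}\vartheta,h\big\rangle:=-\int_0^T\big\langle\partial_t h(t),(-\Delta_N+\gamma I)^{-1}\partial_t\vartheta(t)\big\rangle\,dt ,$$ the pairing between $H^{-1}_0(\Omega)$ and $H^1(\Omega)$ being used under the integral (this is the weak form that incorporates homogeneous Neumann conditions in time). Then: 1. $E$ is Fréchet differentiable on $\mathbb X$ and, for all $\vartheta,h\in\mathbb X$, $$E'(\vartheta)h=\langle A\vartheta-\psi,Ah\rangle_{\mathbb Y}+\alpha\langle\vartheta,h\rangle_{L^2(0,T;L^2(\Omega))}-\beta\big\langle(-\Delta_N+\gamma I)^{-1}\partial_{tt}\vartheta,h\big\rangle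 .$$ 2. $E$ has a unique minimizer $\vartheta$ on $\mathbb X$. It satisfies $E'(\vartheta)=0$, that is, $A^*(A\vartheta-\psi)+\alpha\vartheta-\beta(-\Delta_N+\gamma I)^{-1}\partial_{tt}\vartheta=0$ in the dual space of $\mathbb X$. 3. If moreover $A$ is the restriction to $\mathbb X$ of a continuous linear operator $A:L^2(0,T;L^2(\Omega))\to\mathbb Y$, with Hilbert space adjoint $A^*:\mathbb Y\to L^2(0,T;L^2(\Omega))$, then the minimizer satisfies the homogeneous Neumann condition in time $\partial_t\vartheta(0)=\partial_t\vartheta(T)=0$, in the sense that $(-\Delta_N+\gamma I)^{-1}\partial_t\vartheta$ has a representative in $C([0,T];L^2(\Omega))$ that vanishes at $0$ and $T$; the distribution $(-\Delta_N+\gamma I)^{-1}\partial_{tt}\vartheta$ on $(0,T)$ is a function in $L^2(0,T;L^2(\Omega))$, whose inner product with every $h\in\mathbb X$ is the pairing above; and $$A^*(A\vartheta-\psi)+\alpha\vartheta-\beta(-\Delta_N+\gamma I)^{-1}\partial_{tt}\vartheta=0\quad\text{in }L^2(0,T;L^2(\Omega)).$$ -/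

import Mathlib

open MeasureTheory Set Filter Topology
open scoped ContDiff InnerProductSpace

noncomputable section

namespace TemporalReg

/-- The space `ℝⁿ` with its Euclidean norm. -/
abbrev Rn (n : ℕ) : Type := EuclideanSpace ℝ (Fin n)

/-- The open bounded rectangular domain `∏ᵢ (aᵢ, bᵢ)` of `ℝⁿ`. -/
def box {n : ℕ} (a b : Fin n → ℝ) : Set (Rn n) := {x | ∀ i, x i ∈ Ioo (a i) (b i)}

/-- `φ` is a test function on `U`, that is `φ ∈ C_c^∞(U)`. -/
structure IsTest {E : Type*} [NormedAddCommGroup E] [NormedSpace ℝ E]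
    (U : Set E) (φ : E → ℝ) : Prop where
  smooth : ContDiff ℝ ∞ φ
  compact : HasCompactSupport φ
  support : tsupport φ ⊆ U

/-- The real Hilbert space `L²(Ω)`. -/
abbrev L2 {n : ℕ} (Ω : Set (Rn n)) : Type := Lp ℝ 2 (volume.restrict Ω)

/-- The real Hilbert space `L²(Ω; ℝⁿ)` of square-integrable vector fields. -/
abbrev L2vec {n : ℕ} (Ω : Set (Rn n)) : Type := Lp (Rn n) 2 (volume.restrict Ω)

/-- The Bochner space `L²(0,T;V)`. -/
abbrev L2t (T : ℝ) (V : Type*) [NormedAddCommGroup V] : Type _ :=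
  Lp V 2 (volume.restrict (Ioo (0 : ℝ) T))

/-! ### The space `H¹(Ω)` with the `γ`-weighted norm -/

/-- `g` is the weak gradient of `f` on `Ω`. -/
def IsWeakGradient {n : ℕ} (Ω : Set (Rn n)) (f : L2 Ω) (g : L2vec Ω) : Prop :=
  ∀ φ : Rn n → ℝ, IsTest Ω φ → ∀ i : Fin n,
    ∫ x in Ω, f x * fderiv ℝ φ x (EuclideanSpace.single i 1) = - ∫ x in Ω, g x i * φ x

section Helpers

variable {n : ℕ} {Ω : Set (Rn n)}

lemma memLp_of_test {E : Type*} [NormedAddCommGroup E] [NormedSpace ℝ E]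
    {ψ : Rn n → E} (hc : Continuous ψ) (hs : HasCompactSupport ψ) :
    MemLp ψ 2 (volume.restrict Ω) :=
  (hc.memLp_of_hasCompactSupport hs).restrict Ω

lemma memLp_deriv {φ : Rn n → ℝ} (hφ : IsTest Ω φ) (i : Fin n) :
    MemLp (fun x => fderiv ℝ φ x (EuclideanSpace.single i 1)) 2 (volume.restrict Ω) := by
  refine memLp_of_test ?_ ?_
  · exact (hφ.smooth.continuous_fderiv (by simp)).clm_apply continuous_const
  · exact hφ.compact.fderiv_apply ℝ _

lemma memLp_vec {φ : Rn n → ℝ} (hφ : IsTest Ω φ) (i : Fin n) :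
    MemLp (fun x => φ x • (EuclideanSpace.single i (1 : ℝ) : Rn n)) 2 (volume.restrict Ω) := by
  refine memLp_of_test ?_ ?_
  · exact hφ.smooth.continuous.smul continuous_const
  · exact hφ.compact.smul_right

lemma isWeakGradient_iff (f : L2 Ω) (g : L2vec Ω) :
    IsWeakGradient Ω f g ↔ ∀ (φ : Rn n → ℝ) (hφ : IsTest Ω φ) (i : Fin n),
      ⟪(memLp_deriv hφ i).toLp _, f⟫_ℝ = - ⟪(memLp_vec hφ i).toLp _, g⟫_ℝ := by
  unfold IsWeakGradient
  refine forall_congr' fun φ => forall_congr' fun hφ => forall_congr' fun i => ?_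
  have h1 : ⟪(memLp_deriv hφ i).toLp _, f⟫_ℝ
      = ∫ x in Ω, f x * fderiv ℝ φ x (EuclideanSpace.single i 1) := by
    rw [L2.inner_def]
    refine integral_congr_ae ?_
    filter_upwards [(memLp_deriv hφ i).coeFn_toLp] with x hx
    rw [hx]; simp
  have h2 : ⟪(memLp_vec hφ i).toLp _, g⟫_ℝ = ∫ x in Ω, g x i * φ x := by
    rw [L2.inner_def]
    refine integral_congr_ae ?_
    filter_upwards [(memLp_vec hφ i).coeFn_toLp] with x hx
    rw [hx, real_inner_smul_left, EuclideanSpace.inner_single_left]; simp [mul_comm]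
  rw [h1, h2]

end Helpers

/-- The graph of the weak gradient in `L²(Ω) × L²(Ω; ℝⁿ)`, with the first component scaled by
`√γ`: for `γ > 0` its elements are the pairs `(√γ f, ∇f)` with `f ∈ H¹(Ω)`, so that the Hilbert
norm of the product is `(γ ‖f‖² + ‖∇f‖²)^{1/2}`. -/
def h1Submodule {n : ℕ} (γ : ℝ) (Ω : Set (Rn n)) :
    Submodule ℝ (WithLp 2 (L2 Ω × L2vec Ω)) where
  carrier := {z | IsWeakGradient Ω ((√γ)⁻¹ • z.fst) z.snd}
  zero_mem' := by
    simp only [mem_ofPred_eq, isWeakGradient_iff]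
    intro φ hφ i
    simp
  add_mem' := by
    intro z w hz hw
    simp only [mem_ofPred_eq, isWeakGradient_iff] at *
    intro φ hφ i
    have h1 := hz φ hφ i
    have h2 := hw φ hφ i
    simp only [WithLp.add_fst, WithLp.add_snd, smul_add, inner_add_right]
    rw [h1, h2]; ring
  smul_mem' := by
    intro c z hz
    simp only [mem_ofPred_eq, isWeakGradient_iff] at *
    intro φ hφ i
    have h1 := hz φ hφ i
    rw [WithLp.smul_fst, WithLp.smul_snd, smul_comm, real_inner_smul_right, h1,
      real_inner_smul_right, mul_neg]

/-- The Sobolev space `H¹(Ω)` with the norm `‖f‖² = γ ‖f‖²_{L²} + ‖∇f‖²_{L²}`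
(see `H1.norm_sq`). -/
def H1 {n : ℕ} (γ : ℝ) (Ω : Set (Rn n)) : Type := h1Submodule γ Ω

namespace H1

variable {n : ℕ} {γ : ℝ} {Ω : Set (Rn n)}

instance : NormedAddCommGroup (H1 γ Ω) := inferInstanceAs (NormedAddCommGroup (h1Submodule γ Ω))

instance : InnerProductSpace ℝ (H1 γ Ω) := inferInstanceAs (InnerProductSpace ℝ (h1Submodule γ Ω))

/-- The inclusion into the product space. -/
def incl : H1 γ Ω →L[ℝ] WithLp 2 (L2 Ω × L2vec Ω) := (h1Submodule γ Ω).subtypeL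

/-- The inclusion `H¹(Ω) → L²(Ω)`, `f ↦ f`. -/
def val : H1 γ Ω →L[ℝ] L2 Ω := (√γ)⁻¹ • (WithLp.fstL 2 ℝ (L2 Ω) (L2vec Ω) ∘L incl)

/-- The weak gradient `H¹(Ω) → L²(Ω; ℝⁿ)`, `f ↦ ∇f`. -/
def grad : H1 γ Ω →L[ℝ] L2vec Ω := WithLp.sndL 2 ℝ (L2 Ω) (L2vec Ω) ∘L incl

lemma isWeakGradient (f : H1 γ Ω) : IsWeakGradient Ω (val f) (grad f) := f.2

lemma exists_of_isWeakGradient (hγ : 0 < γ) {f : L2 Ω} {g : L2vec Ω}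
    (h : IsWeakGradient Ω f g) : ∃ u : H1 γ Ω, val u = f ∧ grad u = g := by
  have hs : √γ ≠ 0 := (Real.sqrt_pos.2 hγ).ne'
  refine ⟨⟨WithLp.toLp 2 (√γ • f, g), ?_⟩, ?_, rfl⟩
  · change IsWeakGradient Ω ((√γ)⁻¹ • (√γ • f)) g
    rwa [inv_smul_smul₀ hs]
  · change (√γ)⁻¹ • (√γ • f) = f
    rw [inv_smul_smul₀ hs]

lemma inner_eq (hγ : 0 < γ) (f g : H1 γ Ω) :
    ⟪f, g⟫_ℝ = γ * ⟪val f, val g⟫_ℝ + ⟪grad f, grad g⟫_ℝ := by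
  have h1 : ⟪f, g⟫_ℝ = ⟪(incl f).fst, (incl g).fst⟫_ℝ + ⟪grad f, grad g⟫_ℝ :=
    WithLp.prod_inner_apply _ _
  have h2 : ⟪val f, val g⟫_ℝ = (√γ)⁻¹ * ((√γ)⁻¹ * ⟪(incl f).fst, (incl g).fst⟫_ℝ) := by
    change ⟪(√γ)⁻¹ • (incl f).fst, (√γ)⁻¹ • (incl g).fst⟫_ℝ = _
    rw [real_inner_smul_left, real_inner_smul_right]
  rw [h1, h2, ← mul_assoc, ← mul_assoc, mul_assoc γ, ← mul_inv, Real.mul_self_sqrt hγ.le,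
    mul_inv_cancel₀ hγ.ne', one_mul]

lemma norm_sq (hγ : 0 < γ) (f : H1 γ Ω) :
    ‖f‖ ^ 2 = γ * ‖val f‖ ^ 2 + ‖grad f‖ ^ 2 := by
  simpa only [real_inner_self_eq_norm_sq] using inner_eq hγ f f

lemma isClosed_h1Submodule :
    IsClosed (h1Submodule γ Ω : Set (WithLp 2 (L2 Ω × L2vec Ω))) := by
  have : (h1Submodule γ Ω : Set (WithLp 2 (L2 Ω × L2vec Ω))) =
      {z | IsWeakGradient Ω ((√γ)⁻¹ • z.fst) z.snd} := rfl
  rw [this]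
  simp only [isWeakGradient_iff, ofPred_forall]
  refine isClosed_iInter fun φ => isClosed_iInter fun hφ => isClosed_iInter fun i => ?_
  have c2 : Continuous fun z : WithLp 2 (L2 Ω × L2vec Ω) => z.snd :=
    (WithLp.sndL 2 ℝ (L2 Ω) (L2vec Ω)).continuous
  have c1 : Continuous fun z : WithLp 2 (L2 Ω × L2vec Ω) => (√γ)⁻¹ • z.fst :=
    ((√γ)⁻¹ • WithLp.fstL 2 ℝ (L2 Ω) (L2vec Ω)).continuous
  exact isClosed_eq (continuous_const.inner c1) (continuous_const.inner c2).neg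

instance : CompleteSpace (H1 γ Ω) := 
  (isClosed_h1Submodule (γ := γ) (Ω := Ω)).completeSpace_coe

end H1

/-! ### The dual space `H₀⁻¹(Ω)` and the Neumann Laplacian -/

/-- `H₀⁻¹(Ω)`, the dual space of `H¹(Ω)` with respect to the `γ`-weighted norm. -/
abbrev Hneg {n : ℕ} (γ : ℝ) (Ω : Set (Rn n)) : Type := StrongDual ℝ (H1 γ Ω)

section Operators

variable {n : ℕ} {γ : ℝ} {Ω : Set (Rn n)}

/-- For a continuous linear `P : H¹(Ω) → V` into a Hilbert space, the map
`V → H₀⁻¹(Ω)`, `v ↦ (g ↦ ⟨v, P g⟩)`. -/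
def pairing {V : Type*} [NormedAddCommGroup V] [InnerProductSpace ℝ V] (P : H1 γ Ω →L[ℝ] V) :
    V →L[ℝ] Hneg γ Ω :=
  LinearMap.mkContinuous
    { toFun := fun v => innerSL ℝ v ∘L P
      map_add' := fun v w => by ext; simp
      map_smul' := fun c v => by ext; simp }
    ‖P‖
    fun v => (ContinuousLinearMap.opNorm_comp_le _ _).trans
      (by rw [innerSL_apply_norm, mul_comm])

/-- The embedding `L²(Ω) → H₀⁻¹(Ω)`, `f ↦ (g ↦ ∫_Ω f g)`. -/
def toHneg : L2 Ω →L[ℝ] Hneg γ Ω := pairing H1.val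

lemma toHneg_apply (f : L2 Ω) (g : H1 γ Ω) : toHneg f g = ⟪f, H1.val g⟫_ℝ := rfl

/-- The (variational) Neumann Laplace operator `Δ_N : H¹(Ω) → H₀⁻¹(Ω)`,
`(Δ_N f)(g) = - ∫_Ω ∇f · ∇g` for all `g ∈ H¹(Ω)`. -/
def neumannLaplacian : H1 γ Ω →L[ℝ] Hneg γ Ω := -(pairing H1.grad ∘L H1.grad)

lemma neumannLaplacian_apply (f g : H1 γ Ω) :
    neumannLaplacian f g = -⟪H1.grad f, H1.grad g⟫_ℝ := rfl

/-- The operator `(-Δ_N + γ I)⁻¹ : H₀⁻¹(Ω) → H¹(Ω)`, which is the Riesz isomorphism for the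
`γ`-weighted inner product; see `neumannResolvent_spec`. -/
def neumannResolvent : Hneg γ Ω →L[ℝ] H1 γ Ω :=
  LinearMap.mkContinuous
    { toFun := fun φ => (InnerProductSpace.toDual ℝ (H1 γ Ω)).symm φ
      map_add' := fun φ χ => map_add _ φ χ
      map_smul' := fun c φ => by simp }
    1 fun φ => by
      rw [one_mul]; exact ((InnerProductSpace.toDual ℝ (H1 γ Ω)).symm.norm_map φ).le

lemma inner_neumannResolvent (φ : Hneg γ Ω) (g : H1 γ Ω) :
    ⟪neumannResolvent φ, g⟫_ℝ = φ g := InnerProductSpace.toDual_symm_apply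

/-- `neumannResolvent` is the two-sided inverse of `-Δ_N + γ I : H¹(Ω) → H₀⁻¹(Ω)`. -/
lemma neumannResolvent_spec (hγ : 0 < γ) (φ : Hneg γ Ω) (f : H1 γ Ω) :
    -neumannLaplacian f + γ • toHneg (H1.val f) = φ ↔ neumannResolvent φ = f := by
  have key : ∀ g, (-neumannLaplacian f + γ • toHneg (H1.val f) : Hneg γ Ω) g = ⟪f, g⟫_ℝ := by
    intro g
    rw [H1.inner_eq hγ]
    change -(neumannLaplacian f g) + γ * toHneg (H1.val f) g = _
    rw [neumannLaplacian_apply, toHneg_apply]; ring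
  constructor
  · rintro rfl
    refine ext_inner_right ℝ fun g => ?_
    rw [inner_neumannResolvent, key]
  · rintro rfl
    ext g
    rw [key, inner_neumannResolvent]

end Operators

/-! ### The space `𝕏 = L²(0,T;L²(Ω)) ∩ H¹(0,T;H₀⁻¹(Ω))` -/

/-- `v ∈ L²(0,T;H₀⁻¹(Ω))` is the weak time derivative of `ϑ ∈ L²(0,T;L²(Ω))`: for all
`φ ∈ C_c^∞(0,T)`, `∫₀ᵀ φ'(t) ϑ(t) dt = - ∫₀ᵀ φ(t) v(t) dt` as an identity in `H₀⁻¹(Ω)`. -/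
def IsWeakTimeDeriv {n : ℕ} {γ : ℝ} {Ω : Set (Rn n)} (T : ℝ)
    (ϑ : L2t T (L2 Ω)) (v : L2t T (Hneg γ Ω)) : Prop :=
  ∀ φ : ℝ → ℝ, IsTest (Ioo 0 T) φ →
    ∫ t in Ioo 0 T, deriv φ t • toHneg (γ := γ) (ϑ t) = - ∫ t in Ioo 0 T, φ t • v t

lemma integrable_smul_L2t {T : ℝ} {V : Type*} [NormedAddCommGroup V] [NormedSpace ℝ V]
    {η : ℝ → ℝ} (hη : Continuous η) (hs : HasCompactSupport η) (f : L2t T V) :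
    Integrable (fun t => η t • f t) (volume.restrict (Ioo 0 T)) := by
  have hf : Integrable f (volume.restrict (Ioo 0 T)) := (Lp.memLp f).integrable (by norm_num)
  obtain ⟨C, hC⟩ := hs.exists_bound_of_continuous hη
  exact hf.bdd_smul C hη.aestronglyMeasurable (ae_of_all _ hC)

/-- `𝕏 = L²(0,T;L²(Ω)) ∩ H¹(0,T;H₀⁻¹(Ω))`, realised as the set of pairs `(ϑ, ∂ₜϑ)` in
`L²(0,T;L²(Ω)) × L²(0,T;H₀⁻¹(Ω))`, so that its Hilbert norm is
`(‖ϑ‖²_{L²(0,T;L²(Ω))} + ‖∂ₜϑ‖²_{L²(0,T;H₀⁻¹(Ω))})^{1/2}`. -/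
def xSubmodule {n : ℕ} (T γ : ℝ) (Ω : Set (Rn n)) :
    Submodule ℝ (WithLp 2 (L2t T (L2 Ω) × L2t T (Hneg γ Ω))) where
  carrier := {z | IsWeakTimeDeriv T z.fst z.snd}
  zero_mem' := by
    intro φ hφ
    have h1 : ∫ t in Ioo 0 T, deriv φ t • toHneg (γ := γ) (((0 : L2t T (L2 Ω)) : ℝ → L2 Ω) t) = 0 := by
      refine integral_eq_zero_of_ae ?_
      filter_upwards [Lp.coeFn_zero (L2 Ω) 2 (volume.restrict (Ioo 0 T))] with t ht
      rw [ht]; simp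
    have h2 : ∫ t in Ioo 0 T, φ t • (((0 : L2t T (Hneg γ Ω)) : ℝ → Hneg γ Ω) t) = 0 := by
      refine integral_eq_zero_of_ae ?_
      filter_upwards [Lp.coeFn_zero (Hneg γ Ω) 2 (volume.restrict (Ioo 0 T))] with t ht
      rw [ht]; simp
    exact h1.trans (by rw [WithLp.zero_snd, h2, neg_zero])
  add_mem' := by
    intro z w hz hw φ hφ
    have hd : Continuous (deriv φ) := hφ.smooth.continuous_deriv (by simp)
    have hds : HasCompactSupport (deriv φ) := hφ.compact.deriv
    have i1 : ∀ f : L2t T (L2 Ω), Integrable (fun t => deriv φ t • toHneg (γ := γ) (f t))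
        (volume.restrict (Ioo 0 T)) := fun f => by
      simpa only [map_smul] using
        (toHneg (γ := γ) (Ω := Ω)).integrable_comp (integrable_smul_L2t hd hds f)
    have i2 := fun f : L2t T (Hneg γ Ω) => integrable_smul_L2t hφ.smooth.continuous hφ.compact f
    have e1 : ∫ t in Ioo 0 T, deriv φ t • toHneg (γ := γ) ((z.fst + w.fst : L2t T (L2 Ω)) t) =
        (∫ t in Ioo 0 T, deriv φ t • toHneg (γ := γ) (z.fst t)) +
          ∫ t in Ioo 0 T, deriv φ t • toHneg (γ := γ) (w.fst t) := by
      rw [← integral_add (i1 _) (i1 _)]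
      refine integral_congr_ae ?_
      filter_upwards [Lp.coeFn_add z.fst w.fst] with t ht
      simp only [ht, Pi.add_apply, map_add, smul_add]
    have e2 : ∫ t in Ioo 0 T, φ t • ((z.snd + w.snd : L2t T (Hneg γ Ω)) t) =
        (∫ t in Ioo 0 T, φ t • z.snd t) + ∫ t in Ioo 0 T, φ t • w.snd t := by
      rw [← integral_add (i2 _) (i2 _)]
      refine integral_congr_ae ?_
      filter_upwards [Lp.coeFn_add z.snd w.snd] with t ht
      simp only [ht, Pi.add_apply, smul_add]
    rw [WithLp.add_fst, WithLp.add_snd, e1, e2, hz φ hφ, hw φ hφ, neg_add]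
  smul_mem' := by
    intro c z hz φ hφ
    have e1 : ∫ t in Ioo 0 T, deriv φ t • toHneg (γ := γ) ((c • z.fst : L2t T (L2 Ω)) t) =
        c • ∫ t in Ioo 0 T, deriv φ t • toHneg (γ := γ) (z.fst t) := by
      rw [← integral_smul]
      refine integral_congr_ae ?_
      filter_upwards [Lp.coeFn_smul c z.fst] with t ht
      simp only [ht, Pi.smul_apply, map_smul]
      exact smul_comm _ _ _
    have e2 : ∫ t in Ioo 0 T, φ t • ((c • z.snd : L2t T (Hneg γ Ω)) t) =
        c • ∫ t in Ioo 0 T, φ t • z.snd t := by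
      rw [← integral_smul]
      refine integral_congr_ae ?_
      filter_upwards [Lp.coeFn_smul c z.snd] with t ht
      simp only [ht, Pi.smul_apply]
      exact smul_comm _ _ _
    rw [WithLp.smul_fst, WithLp.smul_snd, e1, e2, hz φ hφ, smul_neg]

/-- The Hilbert space `𝕏 = L²(0,T;L²(Ω)) ∩ H¹(0,T;H₀⁻¹(Ω))`. -/
def X {n : ℕ} (T γ : ℝ) (Ω : Set (Rn n)) : Type := xSubmodule T γ Ω

namespace X

variable {n : ℕ} {T γ : ℝ} {Ω : Set (Rn n)}

instance : NormedAddCommGroup (X T γ Ω) := inferInstanceAs (NormedAddCommGroup (xSubmodule T γ Ω))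

instance : NormedSpace ℝ (X T γ Ω) := inferInstanceAs (NormedSpace ℝ (xSubmodule T γ Ω))

/-- The inclusion into the product space. -/
def incl : X T γ Ω →L[ℝ] WithLp 2 (L2t T (L2 Ω) × L2t T (Hneg γ Ω)) := (xSubmodule T γ Ω).subtypeL

/-- The inclusion `𝕏 → L²(0,T;L²(Ω))`, `ϑ ↦ ϑ`. -/
def val : X T γ Ω →L[ℝ] L2t T (L2 Ω) :=
  WithLp.fstL 2 ℝ (L2t T (L2 Ω)) (L2t T (Hneg γ Ω)) ∘L incl

/-- The weak time derivative `𝕏 → L²(0,T;H₀⁻¹(Ω))`, `ϑ ↦ ∂ₜϑ`. -/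
def dt : X T γ Ω →L[ℝ] L2t T (Hneg γ Ω) :=
  WithLp.sndL 2 ℝ (L2t T (L2 Ω)) (L2t T (Hneg γ Ω)) ∘L incl

lemma norm_sq (ϑ : X T γ Ω) : ‖ϑ‖ ^ 2 = ‖val ϑ‖ ^ 2 + ‖dt ϑ‖ ^ 2 :=
  WithLp.prod_norm_sq_eq_of_L2 (incl ϑ)

lemma isWeakTimeDeriv (ϑ : X T γ Ω) : IsWeakTimeDeriv T (val ϑ) (dt ϑ) := ϑ.2

end X

section Functional

variable {n : ℕ} {T γ : ℝ} {Ω Ω' : Set (Rn n)}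

/-- The functional `E(ϑ) = ½ ‖Aϑ - ψ‖² + (α/2) ‖ϑ‖² + (β/2) ‖∂ₜϑ‖²`, with the norms of
`L²(0,T;L²(Ω'))`, `L²(0,T;L²(Ω))` and `L²(0,T;H₀⁻¹(Ω))`. -/
def energy (A : X T γ Ω →L[ℝ] L2t T (L2 Ω')) (ψ : L2t T (L2 Ω')) (α β : ℝ) (ϑ : X T γ Ω) : ℝ :=
  1 / 2 * ‖A ϑ - ψ‖ ^ 2 + α / 2 * ‖X.val ϑ‖ ^ 2 + β / 2 * ‖X.dt ϑ‖ ^ 2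

/-- The function `w ∈ L²(0,T;L²(Ω))` is `(-Δ_N + γ I)⁻¹ ∂ₜₜϑ`. Here `∂ₜₜϑ` is the
`H₀⁻¹(Ω)`-valued distribution `φ ↦ ∫₀ᵀ φ''(t) ϑ(t) dt` on `(0,T)`, to whose values the operator
`(-Δ_N + γ I)⁻¹` is applied. -/
def IsResolventDtt (ϑ : X T γ Ω) (w : L2t T (L2 Ω)) : Prop :=
  ∀ φ : ℝ → ℝ, IsTest (Ioo 0 T) φ →
    H1.val (neumannResolvent
      (∫ t in Ioo 0 T, deriv (deriv φ) t • toHneg (γ := γ) (X.val ϑ t))) =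
      ∫ t in Ioo 0 T, φ t • w t

/-- The homogeneous Neumann condition in time, `∂ₜϑ(0) = ∂ₜϑ(T) = 0`. As `∂ₜϑ` is only a class in
`L²(0,T;H₀⁻¹(Ω))`, the boundary values are those of `(-Δ_N + γ I)⁻¹ ∂ₜϑ`, which is required to have
a representative in `C([0,T];L²(Ω))` that vanishes at `0` and at `T`. -/
def NeumannInTime (ϑ : X T γ Ω) : Prop :=
  ∃ u : ℝ → L2 Ω, ContinuousOn u (Icc 0 T) ∧ u 0 = 0 ∧ u T = 0 ∧
    ∀ᵐ t ∂(volume.restrict (Ioo 0 T)), H1.val (neumannResolvent (X.dt ϑ t)) = u t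

/-- The pairing of `(-Δ_N + γ I)⁻¹ ∂ₜₜϑ` with `h ∈ 𝕏` in the weak formulation that incorporates the
homogeneous Neumann conditions in time,
`- ∫₀ᵀ ⟨∂ₜh(t), (-Δ_N + γ I)⁻¹ ∂ₜϑ(t)⟩ dt`. -/
def resolventDttPairing (ϑ h : X T γ Ω) : ℝ :=
  - ∫ t in Ioo 0 T, (X.dt h t) (neumannResolvent (X.dt ϑ t))

end Functional

end TemporalReg

end

/-!
The Riesz isomorphism `(-Δ_N + γ I)⁻¹ : H₀⁻¹(Ω) → H¹(Ω)`, applied pointwise in time, is an isometry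
of `L²(0,T;H₀⁻¹(Ω))` into the Hilbert space `L²(0,T;H¹(Ω))`; `X.rdt ϑ` denotes the image of `∂ₜϑ`.
The pairing in the weak formulation is then `-⟪X.rdt ϑ, X.rdt h⟫` (`X.resolventDttPairing_eq`).
With the operator `J ϑ = (A ϑ, √α ϑ, √β X.rdt ϑ)` into a product of Hilbert spaces, the energy is
the least squares functional `½ ‖J ϑ - (ψ, 0, 0)‖²` (`energy_eq`), which gives its derivative
(`hasFDerivAt_energy`). As `α, β > 0`, the operator `J` is bounded below, and `𝕏` is complete
because the weak time derivative is a closed operator (`X.isClosed_xSubmodule`). Hence the range of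
`J` is closed, and the orthogonal projection of `(ψ, 0, 0)` onto it provides a minimizer `ϑ` with
`E(η) = E(ϑ) + ½ ‖J (η - ϑ)‖²` for all `η` (`exists_energy_eq`), so that `ϑ` is unique.

If `A` is the restriction of an operator `B` on `L²(0,T;L²(Ω))`, the weak optimality condition says
that the pairing of `(-Δ_N + γ I)⁻¹ ∂ₜₜϑ` with `h` is `⟪w, h⟫`, where
`w = β⁻¹ (B* (B ϑ - ψ) + α ϑ)`. The elements `h(t) = φ(t) f` of `𝕏`, with `f ∈ L²(Ω)` and `φ` smooth
on all of `ℝ`, turn this into `∫ φ' v = -∫ φ w` in `L²(Ω)` with `v = (-Δ_N + γ I)⁻¹ ∂ₜϑ`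
(`val_integral_deriv_smul_rdt`). For `φ ∈ C_c^∞(0,T)` this identifies `w` as the distribution
`(-Δ_N + γ I)⁻¹ ∂ₜₜϑ`. As `φ` is free at the endpoints, it also implies that `v` agrees almost
everywhere with `t ↦ ∫₀ᵗ w`, which vanishes at `0` and `T`
(`exists_continuousOn_rep_of_integral_deriv_smul`); this is the Neumann condition in time.
-/

noncomputable section

namespace TemporalReg

/-! ### Scalar weights in Bochner spaces -/

section Weights

variable {T : ℝ} {V : Type*} [NormedAddCommGroup V]

lemma exists_bound_ae_Ioo {φ : ℝ → ℝ} (hφ : Continuous φ) :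
    ∃ C, ∀ᵐ t ∂(volume.restrict (Ioo (0 : ℝ) T)), ‖φ t‖ ≤ C := by
  obtain ⟨C, hC⟩ := (isCompact_Icc (a := (0 : ℝ)) (b := T)).exists_bound_of_continuousOn
    hφ.continuousOn
  refine ⟨C, ?_⟩
  filter_upwards [ae_restrict_mem measurableSet_Ioo] with t ht
  exact hC t (Ioo_subset_Icc_self ht)

lemma L2t.integrable (f : L2t T V) : Integrable f (volume.restrict (Ioo 0 T)) :=
  (Lp.memLp f).integrable (by norm_num)

variable [NormedSpace ℝ V]

lemma integrable_continuous_smul {φ : ℝ → ℝ} (hφ : Continuous φ) {f : ℝ → V}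
    (hf : Integrable f (volume.restrict (Ioo 0 T))) :
    Integrable (fun t => φ t • f t) (volume.restrict (Ioo 0 T)) := by
  obtain ⟨C, hC⟩ := exists_bound_ae_Ioo (T := T) hφ
  exact hf.bdd_smul C hφ.aestronglyMeasurable hC

lemma memLp_tensor {φ : ℝ → ℝ} (hφ : Continuous φ) (c : V) :
    MemLp (fun t => φ t • c) 2 (volume.restrict (Ioo (0 : ℝ) T)) := by
  obtain ⟨C, hC⟩ := exists_bound_ae_Ioo (T := T) hφ
  refine MemLp.of_bound (hφ.smul continuous_const).aestronglyMeasurable (C * ‖c‖) ?_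
  filter_upwards [hC] with t ht
  rw [norm_smul]
  gcongr

/-- The elementary tensor `φ ⊗ c`, that is the class of `t ↦ φ(t) c` in `L²(0,T;V)`. -/
def tensor {φ : ℝ → ℝ} (hφ : Continuous φ) (c : V) : L2t T V := (memLp_tensor hφ c).toLp _

lemma coeFn_tensor {φ : ℝ → ℝ} (hφ : Continuous φ) (c : V) :
    tensor (T := T) hφ c =ᵐ[volume.restrict (Ioo 0 T)] fun t => φ t • c :=
  MemLp.coeFn_toLp _

lemma compLpL_tensor {W : Type*} [NormedAddCommGroup W] [NormedSpace ℝ W] (P : V →L[ℝ] W)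
    {φ : ℝ → ℝ} (hφ : Continuous φ) (c : V) :
    P.compLpL 2 (volume.restrict (Ioo 0 T)) (tensor hφ c) = tensor hφ (P c) := by
  refine Lp.ext ?_
  filter_upwards [P.coeFn_compLpL (tensor (T := T) hφ c), coeFn_tensor (T := T) hφ c,
    coeFn_tensor (T := T) hφ (P c)] with t h1 h2 h3
  rw [h1, h2, h3, map_smul]

/-- A continuous linear operator, applied pointwise, commutes with weighted Bochner integrals. -/
lemma integral_smul_compLpL {W : Type*} [NormedAddCommGroup W] [NormedSpace ℝ W]
    [CompleteSpace V] [CompleteSpace W] (P : V →L[ℝ] W) {φ : ℝ → ℝ} (hφ : Continuous φ)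
    (f : L2t T V) :
    ∫ t in Ioo 0 T, φ t • P.compLpL 2 (volume.restrict (Ioo 0 T)) f t =
      P (∫ t in Ioo 0 T, φ t • f t) := by
  rw [← P.integral_comp_comm (integrable_continuous_smul hφ (L2t.integrable f))]
  refine integral_congr_ae ?_
  filter_upwards [P.coeFn_compLpL f] with t ht
  rw [ht, map_smul]

end Weights

lemma inner_tensor_left {T : ℝ} {V : Type*} [NormedAddCommGroup V] [InnerProductSpace ℝ V]
    [CompleteSpace V] {φ : ℝ → ℝ} (hφ : Continuous φ) (c : V) (f : L2t T V) :
    ⟪tensor hφ c, f⟫_ℝ = ⟪c, ∫ t in Ioo 0 T, φ t • f t⟫_ℝ := by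
  rw [← integral_inner (integrable_continuous_smul hφ (L2t.integrable f)), L2.inner_def]
  refine integral_congr_ae ?_
  filter_upwards [coeFn_tensor (T := T) hφ c] with t ht
  rw [ht, real_inner_smul_left, real_inner_smul_right]

/-- Integration by parts for an elementary tensor. -/
lemma integral_deriv_smul_tensor {T : ℝ} {V : Type*} [NormedAddCommGroup V] [NormedSpace ℝ V]
    [CompleteSpace V] {η φ : ℝ → ℝ} (hη : IsTest (Ioo 0 T) η) (hφ : ContDiff ℝ ∞ φ) (c : V) :
    ∫ t in Ioo 0 T, deriv η t • tensor (T := T) hφ.continuous c t =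
      -∫ t in Ioo 0 T, η t • tensor (T := T) (hφ.continuous_deriv (by simp)) c t := by
  have hφ' : Continuous (deriv φ) := hφ.continuous_deriv (by simp)
  have hη' : Continuous (deriv η) := hη.smooth.continuous_deriv (by simp)
  have e : ∀ {χ ρ : ℝ → ℝ} (hρ : Continuous ρ),
      ∫ t in Ioo 0 T, χ t • tensor (T := T) hρ c t = (∫ t in Ioo 0 T, χ t * ρ t) • c := by
    intro χ ρ hρ
    rw [← integral_smul_const]
    refine integral_congr_ae ?_
    filter_upwards [coeFn_tensor (T := T) hρ c] with t ht
    rw [ht, smul_smul]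
  have z0 : ∀ t ∉ Ioo 0 T, t ∉ tsupport η := fun t ht h => ht (hη.support h)
  have f1 : ∫ t in Ioo 0 T, deriv η t * φ t = ∫ t, deriv η t * φ t :=
    setIntegral_eq_integral_of_forall_compl_eq_zero fun t ht => by
      rw [image_eq_zero_of_notMem_tsupport fun h => z0 t ht (tsupport_deriv_subset h), zero_mul]
  have f2 : ∫ t in Ioo 0 T, η t * deriv φ t = ∫ t, η t * deriv φ t :=
    setIntegral_eq_integral_of_forall_compl_eq_zero fun t ht => by
      rw [image_eq_zero_of_notMem_tsupport (z0 t ht), zero_mul]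
  have parts : ∫ t, η t * deriv φ t = -∫ t, deriv η t * φ t :=
    integral_mul_deriv_eq_deriv_mul_of_integrable
      (fun t _ => (hη.smooth.differentiable (by simp) t).hasDerivAt)
      (fun t _ => (hφ.differentiable (by simp) t).hasDerivAt)
      ((hη.smooth.continuous.mul hφ').integrable_of_hasCompactSupport hη.compact.mul_right)
      ((hη'.mul hφ.continuous).integrable_of_hasCompactSupport hη.compact.deriv.mul_right)
      ((hη.smooth.continuous.mul hφ.continuous).integrable_of_hasCompactSupport
        hη.compact.mul_right)
  rw [e, e, f1, f2, parts, neg_smul, neg_neg]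

/-! ### A du Bois-Reymond lemma with free boundary values -/

section FreeBoundary

variable {T : ℝ} {V : Type*} [NormedAddCommGroup V] [NormedSpace ℝ V] [CompleteSpace V]

/-- Integration by parts against the primitive of an integrable function, from Fubini's theorem
on the triangle `{t < s}`. -/
lemma integral_primitive_smul {g : ℝ → ℝ} (hg : Continuous g) {w : ℝ → V}
    (hw : Integrable w (volume.restrict (Ioo 0 T))) :
    ∫ t in Ioo 0 T, (∫ s in T..t, g s) • w t =
      -∫ s in Ioo 0 T, g s • ∫ t in (0 : ℝ)..s, w t := by
  set μ : Measure ℝ := volume.restrict (Ioo 0 T) with hμ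
  have hgi : Integrable g μ := by
    simpa using integrable_continuous_smul (V := ℝ) hg
      (T := T) (f := fun _ => 1) (integrable_const _)
  let F : ℝ → ℝ → V := fun t s => (Ioi t).indicator (fun s => g s • w t) s
  have hF : Integrable (Function.uncurry F) (μ.prod μ) := by
    have h0 : Integrable (fun p : ℝ × ℝ => g p.1 • w p.2) (μ.prod μ) := hgi.smul_prod hw
    have h1 : Integrable (fun p : ℝ × ℝ => g p.2 • w p.1) (μ.prod μ) := h0.swap
    exact h1.indicator (measurableSet_lt measurable_fst measurable_snd)
  have hswap := integral_integral_swap hF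
  have hl : ∫ t, ∫ s, F t s ∂μ ∂μ = -∫ t, (∫ s in T..t, g s) • w t ∂μ := by
    rw [← integral_neg]
    refine integral_congr_ae ?_
    filter_upwards [ae_restrict_mem measurableSet_Ioo] with t ht
    have hset : Ioo 0 T ∩ Ioi t = Ioo t T := by
      ext s; simp only [mem_inter_iff, mem_Ioo, mem_Ioi]
      exact ⟨fun h => ⟨h.2, h.1.2⟩, fun h => ⟨⟨ht.1.trans h.1, h.2⟩, h.1⟩⟩
    simp only [F]
    rw [integral_indicator measurableSet_Ioi, hμ, Measure.restrict_restrict measurableSet_Ioi,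
      inter_comm, hset, integral_smul_const, ← integral_Ioc_eq_integral_Ioo,
      ← intervalIntegral.integral_of_le ht.2.le, intervalIntegral.integral_symm, neg_smul]
  have hr : ∫ s, ∫ t, F t s ∂μ ∂μ = ∫ s, g s • (∫ t in (0 : ℝ)..s, w t) ∂μ := by
    refine integral_congr_ae ?_
    filter_upwards [ae_restrict_mem measurableSet_Ioo] with s hs
    have hset : Ioo 0 T ∩ Iio s = Ioo 0 s := by
      ext t; simp only [mem_inter_iff, mem_Ioo, mem_Iio]
      exact ⟨fun h => ⟨h.1.1, h.2⟩, fun h => ⟨⟨h.1, h.2.trans hs.2⟩, h.2⟩⟩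
    have hFs : (fun t => F t s) = (Iio s).indicator fun t => g s • w t := by
      ext t; simp only [F, indicator, mem_Ioi, mem_Iio]
    simp only [hFs]
    rw [integral_indicator measurableSet_Iio, hμ, Measure.restrict_restrict measurableSet_Iio,
      inter_comm, hset, integral_smul, ← integral_Ioc_eq_integral_Ioo,
      ← intervalIntegral.integral_of_le hs.1.le]
  rw [← hr, ← hswap, hl, neg_neg]

/-- If `w` is the weak derivative of `v` even against test functions that need not vanish at the
endpoints, then `v` has a continuous representative that vanishes at both endpoints, namely the
primitive of `w`. -/
lemma exists_continuousOn_rep_of_integral_deriv_smul (hT : 0 < T) {v w : ℝ → V}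
    (hv : Integrable v (volume.restrict (Ioo 0 T)))
    (hw : Integrable w (volume.restrict (Ioo 0 T)))
    (h : ∀ φ : ℝ → ℝ, ContDiff ℝ ∞ φ →
      ∫ t in Ioo 0 T, deriv φ t • v t = -∫ t in Ioo 0 T, φ t • w t) :
    ∃ u : ℝ → V, ContinuousOn u (Icc 0 T) ∧ u 0 = 0 ∧ u T = 0 ∧
      ∀ᵐ t ∂(volume.restrict (Ioo 0 T)), v t = u t := by
  have hwI : IntegrableOn w (Icc 0 T) := by
    rw [integrableOn_Icc_iff_integrableOn_Ioo]; exact hw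
  set u : ℝ → V := fun t => ∫ s in (0 : ℝ)..t, w s with hu
  have huc : ContinuousOn u (Icc 0 T) := by
    have := intervalIntegral.continuousOn_primitive_interval (a := 0) (b := T) (f := w)
      (μ := volume) (by rwa [uIcc_of_le hT.le])
    rwa [uIcc_of_le hT.le] at this
  have hui : Integrable u (volume.restrict (Ioo 0 T)) :=
    (huc.integrableOn_compact isCompact_Icc).mono_set Ioo_subset_Icc_self
  refine ⟨u, huc, intervalIntegral.integral_same, ?_, ?_⟩
  · -- the test function `φ = 1` shows that `w` has mean zero
    have h1 := h (fun _ => 1) contDiff_const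
    simp only [deriv_const, zero_smul, integral_zero, one_smul] at h1
    simp only [hu]
    rw [intervalIntegral.integral_of_le hT.le, integral_Ioc_eq_integral_Ioo]
    exact neg_eq_zero.1 h1.symm
  · have key : ∀ᵐ t ∂(volume.restrict (Ioo 0 T)), t ∈ univ → (v - u) t = 0 := by
      refine isOpen_univ.ae_eq_zero_of_integral_contDiff_smul_eq_zero
        ((hv.sub hui).locallyIntegrable.locallyIntegrableOn _) fun g hg _ _ => ?_
      -- every smooth `g` is the derivative of the smooth function `φ(t) = ∫_T^t g`
      have hder : deriv (fun t => ∫ s in T..t, g s) = g := by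
        ext t; exact hg.continuous.deriv_integral g T t
      have hφ : ContDiff ℝ ∞ fun t => ∫ s in T..t, g s := by
        rw [contDiff_infty_iff_deriv, hder]
        exact ⟨fun t => (hg.continuous.integral_hasStrictDerivAt T t).hasDerivAt.differentiableAt,
          hg⟩
      have h2 := h _ hφ
      rw [hder, integral_primitive_smul hg.continuous hw, neg_neg] at h2
      simp only [Pi.sub_apply, smul_sub]
      rw [integral_sub (integrable_continuous_smul hg.continuous hv)
        (integrable_continuous_smul hg.continuous hui), h2, sub_self]
    filter_upwards [key] with t ht
    exact sub_eq_zero.1 (ht (mem_univ t))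

end FreeBoundary

/-! ### The space `𝕏` -/

namespace X

variable {n : ℕ} {T γ : ℝ} {Ω : Set (Rn n)}

/-- The operator `(-Δ_N + γ I)⁻¹` applied pointwise in time,
`L²(0,T;H₀⁻¹(Ω)) → L²(0,T;H¹(Ω))`. -/
def resolventL2t : L2t T (Hneg γ Ω) →L[ℝ] L2t T (H1 γ Ω) :=
  neumannResolvent.compLpL 2 (volume.restrict (Ioo 0 T))

lemma coeFn_resolventL2t (v : L2t T (Hneg γ Ω)) :
    resolventL2t v =ᵐ[volume.restrict (Ioo 0 T)] fun t => neumannResolvent (v t) :=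
  neumannResolvent.coeFn_compLpL v

lemma norm_neumannResolvent (φ : Hneg γ Ω) : ‖neumannResolvent φ‖ = ‖φ‖ :=
  (InnerProductSpace.toDual ℝ (H1 γ Ω)).symm.norm_map φ

lemma norm_resolventL2t (v : L2t T (Hneg γ Ω)) : ‖resolventL2t v‖ = ‖v‖ := by
  rw [Lp.norm_def, Lp.norm_def]
  congr 1
  refine eLpNorm_congr_norm_ae ?_
  filter_upwards [coeFn_resolventL2t v] with t ht
  rw [ht, norm_neumannResolvent]

/-- The function `(-Δ_N + γ I)⁻¹ ∂ₜϑ ∈ L²(0,T;H¹(Ω))`. Unlike `∂ₜϑ` it lies in a space that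
carries an inner product in Mathlib, and it has the same norm. -/
def rdt : X T γ Ω →L[ℝ] L2t T (H1 γ Ω) := resolventL2t ∘L dt

lemma norm_rdt (ϑ : X T γ Ω) : ‖rdt ϑ‖ = ‖dt ϑ‖ := norm_resolventL2t _

lemma resolventDttPairing_eq (ϑ h : X T γ Ω) :
    resolventDttPairing ϑ h = -⟪rdt ϑ, rdt h⟫_ℝ := by
  rw [resolventDttPairing, L2.inner_def]
  congr 1
  refine integral_congr_ae ?_
  filter_upwards [coeFn_resolventL2t (dt ϑ), coeFn_resolventL2t (dt h)] with t h1 h2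
  change _ = ⟪resolventL2t (dt ϑ) t, resolventL2t (dt h) t⟫_ℝ
  rw [h1, h2, real_inner_comm, inner_neumannResolvent]

/-- The weak time derivative characterised by inner products with fixed elements of
`L²(0,T;L²(Ω))` and `L²(0,T;H¹(Ω))`. -/
lemma isWeakTimeDeriv_iff (ϑ : L2t T (L2 Ω)) (v : L2t T (Hneg γ Ω)) :
    IsWeakTimeDeriv T ϑ v ↔ ∀ (φ : ℝ → ℝ) (hφ : IsTest (Ioo 0 T) φ) (g : H1 γ Ω),
      ⟪tensor (hφ.smooth.continuous_deriv (by simp)) (H1.val g), ϑ⟫_ℝ =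
        -⟪tensor hφ.smooth.continuous g, resolventL2t v⟫_ℝ := by
  refine forall_congr' fun φ => forall_congr' fun hφ => ?_
  have hd : Continuous (deriv φ) := hφ.smooth.continuous_deriv (by simp)
  rw [ContinuousLinearMap.ext_iff]
  refine forall_congr' fun g => ?_
  have e1 : ∫ t in Ioo 0 T, deriv φ t • toHneg (γ := γ) (ϑ t) =
      toHneg (∫ t in Ioo 0 T, deriv φ t • ϑ t) := by
    rw [← (toHneg (γ := γ)).integral_comp_comm (integrable_continuous_smul hd (L2t.integrable ϑ))]
    simp only [map_smul]
  have e2 : (∫ t in Ioo 0 T, φ t • v t) g =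
      ⟪g, ∫ t in Ioo 0 T, φ t • resolventL2t v t⟫_ℝ := by
    rw [resolventL2t, integral_smul_compLpL _ hφ.smooth.continuous, real_inner_comm,
      inner_neumannResolvent]
  rw [inner_tensor_left, inner_tensor_left, e1, toHneg_apply, real_inner_comm, ← e2]
  rfl

lemma isClosed_xSubmodule :
    IsClosed (xSubmodule T γ Ω : Set (WithLp 2 (L2t T (L2 Ω) × L2t T (Hneg γ Ω)))) := by
  have : (xSubmodule T γ Ω : Set (WithLp 2 (L2t T (L2 Ω) × L2t T (Hneg γ Ω)))) =
      {z | IsWeakTimeDeriv T z.fst z.snd} := rfl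
  rw [this]
  simp only [isWeakTimeDeriv_iff, ofPred_forall]
  refine isClosed_iInter fun φ => isClosed_iInter fun hφ => isClosed_iInter fun g => ?_
  have c1 : Continuous fun z : WithLp 2 (L2t T (L2 Ω) × L2t T (Hneg γ Ω)) => z.fst :=
    (WithLp.fstL 2 ℝ _ _).continuous
  have c2 : Continuous fun z : WithLp 2 (L2t T (L2 Ω) × L2t T (Hneg γ Ω)) =>
      resolventL2t z.snd :=
    (resolventL2t ∘L WithLp.sndL 2 ℝ _ _).continuous
  exact isClosed_eq (continuous_const.inner c1) (continuous_const.inner c2).neg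

instance : CompleteSpace (X T γ Ω) :=
  (isClosed_xSubmodule (T := T) (γ := γ) (Ω := Ω)).completeSpace_coe

lemma isWeakTimeDeriv_tensor {φ : ℝ → ℝ} (hφ : ContDiff ℝ ∞ φ) (f : L2 Ω) :
    IsWeakTimeDeriv (γ := γ) T (tensor hφ.continuous f)
      (tensor (hφ.continuous_deriv (by simp)) (toHneg f)) := by
  intro η hη
  rw [← integral_deriv_smul_tensor hη hφ]
  refine integral_congr_ae ?_
  filter_upwards [coeFn_tensor (T := T) hφ.continuous f,
    coeFn_tensor (T := T) hφ.continuous (toHneg (γ := γ) f)] with t h1 h2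
  rw [h1, h2, map_smul]

/-- The element `φ ⊗ f` of `𝕏`, for `φ` smooth on `ℝ` and `f ∈ L²(Ω)`; its time derivative is
`φ' ⊗ f`. The function `φ` is not required to vanish at `0` and `T`. -/
def ofTensor {φ : ℝ → ℝ} (hφ : ContDiff ℝ ∞ φ) (f : L2 Ω) : X T γ Ω :=
  ⟨WithLp.toLp 2 (tensor hφ.continuous f, tensor (hφ.continuous_deriv (by simp)) (toHneg f)),
    isWeakTimeDeriv_tensor hφ f⟩

lemma val_ofTensor {φ : ℝ → ℝ} (hφ : ContDiff ℝ ∞ φ) (f : L2 Ω) :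
    val (ofTensor (T := T) (γ := γ) hφ f) = tensor hφ.continuous f := rfl

lemma rdt_ofTensor {φ : ℝ → ℝ} (hφ : ContDiff ℝ ∞ φ) (f : L2 Ω) :
    rdt (ofTensor (T := T) (γ := γ) hφ f) =
      tensor (hφ.continuous_deriv (by simp)) (neumannResolvent (toHneg f)) :=
  compLpL_tensor neumannResolvent _ _

end X

/-! ### Regularity in time of solutions of the weak equation -/

section Regularity

variable {n : ℕ} {T γ : ℝ} {Ω : Set (Rn n)} {ϑ : X T γ Ω} {w : L2t T (L2 Ω)}

/-- Testing with `φ ⊗ f` turns the weak equation into an identity in `L²(Ω)`, for all smooth `φ`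
with arbitrary boundary values. -/
lemma val_integral_deriv_smul_rdt
    (hw : ∀ h : X T γ Ω, resolventDttPairing ϑ h = ⟪w, X.val h⟫_ℝ)
    {φ : ℝ → ℝ} (hφ : ContDiff ℝ ∞ φ) :
    H1.val (∫ t in Ioo 0 T, deriv φ t • X.rdt ϑ t) = -∫ t in Ioo 0 T, φ t • w t := by
  refine ext_inner_left ℝ fun f => ?_
  have h := hw (X.ofTensor hφ f)
  rw [X.resolventDttPairing_eq, X.rdt_ofTensor, X.val_ofTensor, real_inner_comm,
    inner_tensor_left, inner_neumannResolvent, toHneg_apply, real_inner_comm _ w,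
    inner_tensor_left] at h
  rw [inner_neg_right, ← h, neg_neg]

/-- The time derivative is moved off the test function twice: first by the definition of `∂ₜϑ`,
applied to the test function `φ'`, then by the weak equation. -/
lemma isResolventDtt_of_pairing
    (hw : ∀ h : X T γ Ω, resolventDttPairing ϑ h = ⟪w, X.val h⟫_ℝ) : IsResolventDtt ϑ w := by
  intro φ hφ
  have hd : Continuous (deriv φ) := hφ.smooth.continuous_deriv (by simp)
  have hφ' : IsTest (Ioo 0 T) (deriv φ) :=
    ⟨(contDiff_infty_iff_deriv.1 hφ.smooth).2, hφ.compact.deriv,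
      tsupport_deriv_subset.trans hφ.support⟩
  have h1 : ∫ t in Ioo 0 T, deriv φ t • X.rdt ϑ t =
      neumannResolvent (∫ t in Ioo 0 T, deriv φ t • X.dt ϑ t) :=
    integral_smul_compLpL neumannResolvent hd (X.dt ϑ)
  rw [X.isWeakTimeDeriv ϑ _ hφ', map_neg, ← h1, map_neg,
    val_integral_deriv_smul_rdt hw hφ.smooth, neg_neg]

/-- The test functions `φ ⊗ f` do not vanish at `0` and `T`, which makes the homogeneous Neumann
condition a natural boundary condition. -/
lemma neumannInTime_of_pairing (hT : 0 < T)
    (hw : ∀ h : X T γ Ω, resolventDttPairing ϑ h = ⟪w, X.val h⟫_ℝ) : NeumannInTime ϑ := by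
  obtain ⟨u, huc, hu0, huT, hu⟩ := exists_continuousOn_rep_of_integral_deriv_smul hT
    (L2t.integrable (H1.val.compLpL 2 (volume.restrict (Ioo 0 T)) (X.rdt ϑ)))
    (L2t.integrable w)
    fun φ hφ => by
      rw [integral_smul_compLpL H1.val (hφ.continuous_deriv (by simp)),
        val_integral_deriv_smul_rdt hw hφ]
  refine ⟨u, huc, hu0, huT, ?_⟩
  filter_upwards [hu, H1.val.coeFn_compLpL (X.rdt ϑ), X.coeFn_resolventL2t (X.dt ϑ)]
    with t h1 h2 h3
  rw [← h1, h2, ← h3]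
  rfl

end Regularity

/-! ### The energy as a least squares functional -/

/-- Least squares in a Hilbert space: the minimizer of `‖J x - z‖` is the preimage of the
projection of `z` onto the range of `J`, which is closed as `J` is bounded below. -/
lemma exists_norm_sub_sq_eq {E H : Type*} [NormedAddCommGroup E] [NormedSpace ℝ E]
    [CompleteSpace E] [NormedAddCommGroup H] [InnerProductSpace ℝ H] [CompleteSpace H]
    (J : E →L[ℝ] H) {K : NNReal} (hJ : AntilipschitzWith K J) (z : H) :
    ∃ x, ∀ y, ‖J y - z‖ ^ 2 = ‖J x - z‖ ^ 2 + ‖J (y - x)‖ ^ 2 := by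
  have hcl : IsClosed (LinearMap.range (J : E →ₗ[ℝ] H) : Set H) := by
    rw [LinearMap.coe_range]
    exact hJ.isClosed_range J.uniformContinuous
  have : CompleteSpace (LinearMap.range (J : E →ₗ[ℝ] H)) := hcl.completeSpace_coe
  obtain ⟨x, hx⟩ := (LinearMap.range (J : E →ₗ[ℝ] H)).starProjection_apply_mem z
  have hxz : J x = (LinearMap.range (J : E →ₗ[ℝ] H)).starProjection z := hx
  refine ⟨x, fun y => ?_⟩
  have horth : ⟪J (y - x), z - J x⟫_ℝ = 0 := by
    rw [hxz]
    exact Submodule.inner_right_of_mem_orthogonal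
      (LinearMap.mem_range_self (J : E →ₗ[ℝ] H) (y - x))
      (Submodule.sub_starProjection_mem_orthogonal z)
  have hsplit : J y - z = J (y - x) - (z - J x) := by rw [map_sub]; abel
  rw [hsplit, @norm_sub_sq_real, horth, norm_sub_rev z]
  ring

section Energy

variable {n : ℕ} {T α β γ : ℝ} {Ω Ω' : Set (Rn n)}

/-- The operator `ϑ ↦ (Aϑ, √α ϑ, √β (-Δ_N + γ I)⁻¹ ∂ₜϑ)`. -/
def lsOperator (A : X T γ Ω →L[ℝ] L2t T (L2 Ω')) (α β : ℝ) :
    X T γ Ω →L[ℝ] WithLp 2 (L2t T (L2 Ω') × WithLp 2 (L2t T (L2 Ω) × L2t T (H1 γ Ω))) :=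
  (WithLp.prodContinuousLinearEquiv 2 ℝ (L2t T (L2 Ω'))
      (WithLp 2 (L2t T (L2 Ω) × L2t T (H1 γ Ω)))).symm.toContinuousLinearMap ∘L
    A.prod ((WithLp.prodContinuousLinearEquiv 2 ℝ (L2t T (L2 Ω))
        (L2t T (H1 γ Ω))).symm.toContinuousLinearMap ∘L (√α • X.val).prod (√β • X.rdt))

lemma lsOperator_apply (A : X T γ Ω →L[ℝ] L2t T (L2 Ω')) (α β : ℝ) (ϑ : X T γ Ω) :
    lsOperator A α β ϑ = WithLp.toLp 2 (A ϑ, WithLp.toLp 2 (√α • X.val ϑ, √β • X.rdt ϑ)) := rfl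

/-- The right-hand side `(ψ, 0, 0)` of the least squares problem. -/
def lsData (γ : ℝ) (Ω : Set (Rn n)) (ψ : L2t T (L2 Ω')) :
    WithLp 2 (L2t T (L2 Ω') × WithLp 2 (L2t T (L2 Ω) × L2t T (H1 γ Ω))) :=
  WithLp.toLp 2 (ψ, 0)

lemma lsOperator_sub_lsData (A : X T γ Ω →L[ℝ] L2t T (L2 Ω')) (α β : ℝ) (ψ : L2t T (L2 Ω'))
    (ϑ : X T γ Ω) : lsOperator A α β ϑ - lsData γ Ω ψ =
      WithLp.toLp 2 (A ϑ - ψ, WithLp.toLp 2 (√α • X.val ϑ, √β • X.rdt ϑ)) := by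
  rw [lsOperator_apply, lsData, ← WithLp.toLp_sub, Prod.mk_sub_mk, sub_zero]

lemma inner_lsOperator_sub (hα : 0 < α) (hβ : 0 < β) (A : X T γ Ω →L[ℝ] L2t T (L2 Ω'))
    (ψ : L2t T (L2 Ω')) (ϑ h : X T γ Ω) :
    ⟪lsOperator A α β ϑ - lsData γ Ω ψ, lsOperator A α β h⟫_ℝ =
      ⟪A ϑ - ψ, A h⟫_ℝ + α * ⟪X.val ϑ, X.val h⟫_ℝ + β * ⟪X.rdt ϑ, X.rdt h⟫_ℝ := by
  rw [lsOperator_sub_lsData, lsOperator_apply, WithLp.prod_inner_apply,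
    WithLp.prod_inner_apply]
  change _ + (⟪√α • X.val ϑ, √α • X.val h⟫_ℝ + ⟪√β • X.rdt ϑ, √β • X.rdt h⟫_ℝ) = _
  rw [real_inner_smul_left, real_inner_smul_right, real_inner_smul_left, real_inner_smul_right,
    ← mul_assoc, ← mul_assoc, Real.mul_self_sqrt hα.le, Real.mul_self_sqrt hβ.le, add_assoc]

lemma norm_lsOperator_sub_sq (hα : 0 < α) (hβ : 0 < β) (A : X T γ Ω →L[ℝ] L2t T (L2 Ω'))
    (ψ : L2t T (L2 Ω')) (ϑ : X T γ Ω) :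
    ‖lsOperator A α β ϑ - lsData γ Ω ψ‖ ^ 2 =
      ‖A ϑ - ψ‖ ^ 2 + α * ‖X.val ϑ‖ ^ 2 + β * ‖X.dt ϑ‖ ^ 2 := by
  rw [lsOperator_sub_lsData, WithLp.prod_norm_sq_eq_of_L2, WithLp.prod_norm_sq_eq_of_L2]
  change ‖A ϑ - ψ‖ ^ 2 + (‖√α • X.val ϑ‖ ^ 2 + ‖√β • X.rdt ϑ‖ ^ 2) = _
  rw [norm_smul, norm_smul, mul_pow, mul_pow, Real.norm_eq_abs, Real.norm_eq_abs, sq_abs, sq_abs,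
    Real.sq_sqrt hα.le, Real.sq_sqrt hβ.le, X.norm_rdt, add_assoc]

lemma energy_eq (hα : 0 < α) (hβ : 0 < β) (A : X T γ Ω →L[ℝ] L2t T (L2 Ω'))
    (ψ : L2t T (L2 Ω')) (ϑ : X T γ Ω) :
    energy A ψ α β ϑ = 1 / 2 * ‖lsOperator A α β ϑ - lsData γ Ω ψ‖ ^ 2 := by
  rw [norm_lsOperator_sub_sq hα hβ, energy]
  ring

lemma mul_norm_sq_le_norm_lsOperator_sq (hα : 0 < α) (hβ : 0 < β)
    (A : X T γ Ω →L[ℝ] L2t T (L2 Ω')) (ϑ : X T γ Ω) :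
    min α β * ‖ϑ‖ ^ 2 ≤ ‖lsOperator A α β ϑ‖ ^ 2 := by
  have h := norm_lsOperator_sub_sq hα hβ A 0 ϑ
  have h0 : lsData γ Ω (0 : L2t T (L2 Ω')) = 0 := rfl
  rw [h0, sub_zero, sub_zero] at h
  rw [h, X.norm_sq, mul_add]
  have h1 := mul_le_mul_of_nonneg_right (min_le_left α β) (sq_nonneg ‖X.val ϑ‖)
  have h2 := mul_le_mul_of_nonneg_right (min_le_right α β) (sq_nonneg ‖X.dt ϑ‖)
  linarith [sq_nonneg ‖A ϑ‖]

lemma exists_antilipschitzWith_lsOperator (hα : 0 < α) (hβ : 0 < β)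
    (A : X T γ Ω →L[ℝ] L2t T (L2 Ω')) : ∃ K, AntilipschitzWith K (lsOperator A α β) := by
  have hm : 0 < min α β := lt_min hα hβ
  refine ⟨(√(min α β)).toNNReal⁻¹, AddMonoidHomClass.antilipschitz_of_bound _ fun ϑ => ?_⟩
  rw [NNReal.coe_inv, Real.coe_toNNReal _ (Real.sqrt_nonneg _), inv_mul_eq_div,
    le_div_iff₀ (Real.sqrt_pos.2 hm)]
  refine le_of_sq_le_sq ?_ (norm_nonneg _)
  rw [mul_pow, Real.sq_sqrt hm.le, mul_comm]
  exact mul_norm_sq_le_norm_lsOperator_sq hα hβ A ϑ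

lemma hasFDerivAt_energy (hα : 0 < α) (hβ : 0 < β) (A : X T γ Ω →L[ℝ] L2t T (L2 Ω'))
    (ψ : L2t T (L2 Ω')) (ϑ : X T γ Ω) :
    HasFDerivAt (energy A ψ α β)
      (innerSL ℝ (lsOperator A α β ϑ - lsData γ Ω ψ) ∘L lsOperator A α β) ϑ := by
  have h := (((lsOperator A α β).hasFDerivAt (x := ϑ)).sub_const (lsData γ Ω ψ)).norm_sq.const_mul
    (1 / 2 : ℝ)
  rw [funext (energy_eq hα hβ A ψ)]
  -- the factor `1 / 2` cancels the `2` from differentiating the square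
  refine h.congr_fderiv ?_
  rw [← Nat.cast_smul_eq_nsmul ℝ, smul_smul]
  norm_num

/-- The minimizer of the energy, with the exact quadratic growth of the energy around it. -/
lemma exists_energy_eq (hα : 0 < α) (hβ : 0 < β) (A : X T γ Ω →L[ℝ] L2t T (L2 Ω'))
    (ψ : L2t T (L2 Ω')) : ∃ ϑ : X T γ Ω, ∀ η,
      energy A ψ α β η = energy A ψ α β ϑ + 1 / 2 * ‖lsOperator A α β (η - ϑ)‖ ^ 2 := by
  obtain ⟨K, hK⟩ := exists_antilipschitzWith_lsOperator hα hβ A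
  obtain ⟨ϑ, hϑ⟩ := exists_norm_sub_sq_eq _ hK (lsData γ Ω ψ)
  refine ⟨ϑ, fun η => ?_⟩
  rw [energy_eq hα hβ, energy_eq hα hβ, hϑ η, mul_add]

end Energy

end TemporalReg

end

open TemporalReg in
theorem mainTheorem6 {n : ℕ} (a b a' b' : Fin n → ℝ)
    (hab : ∀ i, a i < b i) (hab' : ∀ i, a' i < b' i)
    (T α β γ : ℝ) (hT : 0 < T) (hα : 0 < α) (hβ : 0 < β) (hγ : 0 < γ)
    (A : X T γ (box a b) →L[ℝ] L2t T (L2 (box a' b')))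
    (ψ : L2t T (L2 (box a' b'))) :
    -- `E` is Fréchet differentiable on `𝕏`, with the derivative in its weak form
    (∀ ϑ : X T γ (box a b), DifferentiableAt ℝ (energy A ψ α β) ϑ ∧
      ∀ h : X T γ (box a b), fderiv ℝ (energy A ψ α β) ϑ h =
        ⟪A ϑ - ψ, A h⟫_ℝ + α * ⟪X.val ϑ, X.val h⟫_ℝ - β * resolventDttPairing ϑ h) ∧
    ∃ ϑ : X T γ (box a b),
      -- existence and uniqueness of the minimizer
      IsMinOn (energy A ψ α β) univ ϑ ∧
      (∀ η : X T γ (box a b), IsMinOn (energy A ψ α β) univ η → η = ϑ) ∧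
      -- the first order optimality condition, in the dual space of `𝕏`
      fderiv ℝ (energy A ψ α β) ϑ = 0 ∧
      (∀ h : X T γ (box a b),
        ⟪A ϑ - ψ, A h⟫_ℝ + α * ⟪X.val ϑ, X.val h⟫_ℝ - β * resolventDttPairing ϑ h = 0) ∧
      -- the optimality condition in `L²(0,T;L²(Ω))`, for `A` continuous on `L²(0,T;L²(Ω))`
      ∀ B : L2t T (L2 (box a b)) →L[ℝ] L2t T (L2 (box a' b')), (∀ η, A η = B (X.val η)) →
        NeumannInTime ϑ ∧
        ∃ w : L2t T (L2 (box a b)), IsResolventDtt ϑ w ∧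
          (∀ h : X T γ (box a b), resolventDttPairing ϑ h = ⟪w, X.val h⟫_ℝ) ∧
          B.adjoint (B (X.val ϑ) - ψ) + α • X.val ϑ - β • w = 0 := by
  have hderiv : ∀ ϑ h : X T γ (box a b), fderiv ℝ (energy A ψ α β) ϑ h =
      ⟪A ϑ - ψ, A h⟫_ℝ + α * ⟪X.val ϑ, X.val h⟫_ℝ - β * resolventDttPairing ϑ h := by
    intro ϑ h
    rw [(hasFDerivAt_energy hα hβ A ψ ϑ).fderiv, X.resolventDttPairing_eq, mul_neg,
      sub_neg_eq_add, ← inner_lsOperator_sub hα hβ]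
    rfl
  refine ⟨fun ϑ => ⟨(hasFDerivAt_energy hα hβ A ψ ϑ).differentiableAt, hderiv ϑ⟩, ?_⟩
  obtain ⟨ϑ, hϑ⟩ := exists_energy_eq hα hβ A ψ
  have hmin : IsMinOn (energy A ψ α β) univ ϑ := by
    intro η _
    change energy A ψ α β ϑ ≤ energy A ψ α β η
    rw [hϑ η]
    exact le_add_of_nonneg_right (by positivity)
  have hzero : fderiv ℝ (energy A ψ α β) ϑ = 0 :=
    (hmin.isLocalMin univ_mem).fderiv_eq_zero
  have hweak : ∀ h : X T γ (box a b),
      ⟪A ϑ - ψ, A h⟫_ℝ + α * ⟪X.val ϑ, X.val h⟫_ℝ - β * resolventDttPairing ϑ h = 0 := by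
    intro h
    rw [← hderiv, hzero]
    rfl
  refine ⟨ϑ, hmin, ?_, hzero, hweak, ?_⟩
  · intro η hη
    have h1 : energy A ψ α β η ≤ energy A ψ α β ϑ := hη (mem_univ ϑ)
    have h2 := mul_norm_sq_le_norm_lsOperator_sq hα hβ A (η - ϑ)
    have h3 : min α β * ‖η - ϑ‖ ^ 2 ≤ 0 := by linarith [hϑ η]
    have h4 : ‖η - ϑ‖ ^ 2 ≤ 0 := nonpos_of_mul_nonpos_right h3 (lt_min hα hβ)
    exact sub_eq_zero.1 (norm_eq_zero.1 (pow_eq_zero_iff two_ne_zero |>.1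
      (le_antisymm h4 (sq_nonneg _))))
  · intro B hB
    -- the equation itself determines `w`
    set w : L2t T (L2 (box a b)) :=
      β⁻¹ • (B.adjoint (B (X.val ϑ) - ψ) + α • X.val ϑ) with hw
    have hpair : ∀ h : X T γ (box a b), resolventDttPairing ϑ h = ⟪w, X.val h⟫_ℝ := by
      intro h
      have h1 := hweak h
      rw [hB, hB, ← ContinuousLinearMap.adjoint_inner_left] at h1
      rw [hw, real_inner_smul_left, inner_add_left, real_inner_smul_left, eq_inv_mul_iff_mul_eq₀
        hβ.ne']
      linarith
    refine ⟨neumannInTime_of_pairing hT hpair, w, isResolventDtt_of_pairing hpair, hpair, ?_⟩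
    rw [hw, smul_inv_smul₀ hβ.ne', sub_self]
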